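/- **Low-order Morawetz identity.** Let $\nu\ge 1$, let $\Omega\subset\mathbb R^\nu$ be a bounded Lipschitz domain with outward unit normal $\mathbf n$, let $k>0$ and $\beta\in\mathbb R$. Let $dS$ be the surface measure on $\partial\Omega$ (counting measure if $\nu=1$), $\tau:H^1(\Omega)\to H^{1/2}(\partial\Omega)$ the trace operator (we write $u$ for $\tau u$ on $\partial\Omega$), and $\mathscr L u=-\Delta u-k^2u$, with $\Delta$ in the sense of distributions. For $u\in H^1(\Omega)$ with $\Delta u\in L^2(\Omega)$, the normal derivative $\partial_{\mathbf n}u=\nabla u\cdot\mathbf n$ is the element of $H^{-1/2}(\partial\Omega)$ (the antidual of $H^{1/2}(\partial\Omega)$) determined by $\langle\partial_{\mathbf n}u,\varphi|_{\partial\Omega}\rangle=\int_\Omega\nabla u\cdot\overline{\nabla\varphi}\,dx+\int_\Omega\Delta u\,\overline{\varphi}\,dx$ for all functions $\varphi$ smooth on $\overline\Omega$. Put $$\mathscr V=\{v\in H^1(\Omega):\ \mathscr L v\in L^2(\Omega),\ \tau v\in H^1(\partial\Omega),\ \partial_{\mathbf n}v-ikv\in L^2(\partial\Omega)\},\qquad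 M_0u:=-ik\beta u .$$ (i) If $u\in\mathscr V$, then $\tau u$ and $\partial_{\mathbf n}u$ belong to $L^2(\partial\Omega)$, all integrands below are integrable, and $$\int_\Omega 2\,\mathrm{Re}\big(\overline{M_0u}\,\mathscr Lu\big)\,dx-2k^2\beta\int_{\partial\Omega}|u|^2\,dS+2\,\mathrm{Re}\int_{\partial\Omega}ik\beta\,\overline u\,\big(\nabla u\cdot\mathbf n-iku\big)\,dS=0 .$$ (ii) More generally, if $u\in H^1(\Omega)$ and $\mathscr Lu\in L^2(\Omega)$, so that $\partial_{\mathbf n}u$ need not be square integrable, the identity holds with the last boundary integral read as the duality pairing between $H^{-1/2}(\partial\Omega)$ and $H^{1/2}(\partial\Omega)$: $$\int_\Omega 2\,\mathrm{Re}\big(\overline{M_0u}\,\mathscr Lu\big)\,dx-2k^2\beta\int_{\partial\Omega}|u|^2\,dS+2\,\mathrm{Re}\big(ik\beta\,\langle\partial_{\mathbf n}u-iku,\ \tau u\rangle\big)=0 .$$ -/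

import Mathlib

open MeasureTheory Filter Topology
open scoped ContDiff ComplexConjugate

noncomputable section

namespace Helmholtz

/-- The Euclidean space `ℝ^d`. -/
abbrev Eucl (d : ℕ) : Type := EuclideanSpace ℝ (Fin d)

/-- Compactly supported smooth complex-valued functions on `ℝ^d`. Their restrictions to `Ω` are
the functions that are smooth up to the boundary. -/
structure IsTest {d : ℕ} (φ : Eucl d → ℂ) : Prop where
  smooth : ContDiff ℝ ∞ φ
  compact : HasCompactSupport φ

/-- The classical gradient `(∂₁φ, …, ∂_dφ)` of a complex-valued function. -/
def grad {d : ℕ} (φ : Eucl d → ℂ) (x : Eucl d) : EuclideanSpace ℂ (Fin d) :=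
  WithLp.toLp 2 fun i => fderiv ℝ φ x (EuclideanSpace.single i 1)

/-! ### Sobolev functions on an open set -/

/-- `u ∈ H¹(Ω)` with weak gradient `G`: both are square integrable on `Ω`, and
`∫_Ω u ∂ᵢφ = -∫_Ω Gᵢ φ` for all `φ ∈ C_c^∞(Ω)`. -/
structure HasWeakGrad {d : ℕ} (Ω : Set (Eucl d)) (u : Eucl d → ℂ)
    (G : Eucl d → EuclideanSpace ℂ (Fin d)) : Prop where
  memLp : MemLp u 2 (volume.restrict Ω)
  memLp_grad : MemLp G 2 (volume.restrict Ω)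
  integral_eq : ∀ φ : Eucl d → ℂ, IsTest φ → tsupport φ ⊆ Ω → ∀ i : Fin d,
    ∫ x in Ω, u x * grad φ x i = - ∫ x in Ω, G x i * φ x

/-- `u ∈ H¹(Ω)`. -/
def MemH1 {d : ℕ} (Ω : Set (Eucl d)) (u : Eucl d → ℂ) : Prop :=
  ∃ G, HasWeakGrad Ω u G

/-- The distribution `Δu` on `Ω` is the square integrable function `D`:
`∫_Ω u Δφ = ∫_Ω D φ` for all `φ ∈ C_c^∞(Ω)`. -/
structure HasWeakLaplacian {d : ℕ} (Ω : Set (Eucl d)) (u D : Eucl d → ℂ) : Prop where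
  memLp : MemLp D 2 (volume.restrict Ω)
  integral_eq : ∀ φ : Eucl d → ℂ, IsTest φ → tsupport φ ⊆ Ω →
    ∫ x in Ω, u x * Laplacian.laplacian φ x = ∫ x in Ω, D x * φ x

/-- `𝓛u = -Δu - k²u`, where `D` is the (weak) Laplacian of `u`. For `u ∈ L²(Ω)` and `k` real,
`𝓛u ∈ L²(Ω)` if and only if `Δu ∈ L²(Ω)`. -/
def helmholtzOp {d : ℕ} (k : ℝ) (u D : Eucl d → ℂ) (x : Eucl d) : ℂ :=
  - D x - (k : ℂ) ^ 2 * u x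

/-- The multiplier `M₀u = -ikβu`. -/
def multM0 {d : ℕ} (k β : ℝ) (u : Eucl d → ℂ) (x : Eucl d) : ℂ :=
  - Complex.I * k * β * u x

/-! ### Bounded Lipschitz domains -/

/-- Rotated coordinates `(y, t) ↦ j y + t e` of `ℝ^ν = e^⊥ ⊕ ℝ e`, with a function
`h : ℝ^(ν-1) → ℝ` and a set `U`. -/
structure GraphChart (ν : ℕ) where
  U : Set (Eucl ν)
  j : Eucl (ν - 1) →ₗᵢ[ℝ] Eucl ν
  e : Eucl ν
  h : Eucl (ν - 1) → ℝ

/-- Inside the open set `U`, the set `Ω` is the part `t < h y` below the graph of the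
Lipschitz function `h`; hence `∂Ω ∩ U` is the part of the graph of `h` that lies in `U`. -/
structure GraphChart.IsChart {ν : ℕ} (c : GraphChart ν) (Ω : Set (Eucl ν)) : Prop where
  isOpen : IsOpen c.U
  norm_e : ‖c.e‖ = 1
  orth : ∀ y, inner ℝ (c.j y) c.e = 0
  lipschitz : ∃ K : NNReal, LipschitzWith K c.h
  mem_iff : ∀ (y : Eucl (ν - 1)) (t : ℝ), c.j y + t • c.e ∈ c.U →
    (c.j y + t • c.e ∈ Ω ↔ t < c.h y)

/-- The parametrization `y ↦ (y, h y)` of the graph. -/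
def GraphChart.param {ν : ℕ} (c : GraphChart ν) (y : Eucl (ν - 1)) : Eucl ν :=
  c.j y + c.h y • c.e

/-- Bounded Lipschitz domain: a bounded, open, connected, nonempty set that near each of its
boundary points is, in suitable rotated coordinates, the region on one side of the graph of a
Lipschitz function. -/
structure IsBoundedLipschitzDomain {ν : ℕ} (Ω : Set (Eucl ν)) : Prop where
  isOpen : IsOpen Ω
  isConnected : IsConnected Ω
  isBounded : Bornology.IsBounded Ω
  exists_chart : ∀ p ∈ frontier Ω, ∃ c : GraphChart ν, c.IsChart Ω ∧ p ∈ c.U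

/-- The surface measure `dS` on `∂Ω`: the `(ν-1)`-dimensional Hausdorff measure, normalised to
agree with Lebesgue measure on `ℝ^(ν-1)`. For `ν = 1` it is the counting measure. -/
def surf {ν : ℕ} (Ω : Set (Eucl ν)) : Measure (Eucl ν) :=
  (Measure.euclideanHausdorffMeasure (ν - 1)).restrict (frontier Ω)

/-! ### Traces, `H^{1/2}(∂Ω)`, its antidual, and `H¹(∂Ω)` -/

/-- `g ∈ L²(∂Ω)` is the trace of `v ∈ H¹(Ω)`. The trace operator is the continuous extension of
the restriction `φ ↦ φ|_{∂Ω}` from smooth functions to `H¹(Ω)`: `g` is the limit in `L²(∂Ω)` of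
`φₙ|_{∂Ω}` for some smooth `φₙ` that tend to `v` in `H¹(Ω)`. -/
def IsTrace {ν : ℕ} (Ω : Set (Eucl ν)) (v : Eucl ν → ℂ) (g : Lp ℂ 2 (surf Ω)) : Prop :=
  ∃ G, HasWeakGrad Ω v G ∧ ∃ φ : ℕ → Eucl ν → ℂ, (∀ n, IsTest (φ n)) ∧
    Tendsto (fun n => eLpNorm (φ n - v) 2 (volume.restrict Ω)) atTop (𝓝 0) ∧
    Tendsto (fun n => eLpNorm (grad (φ n) - G) 2 (volume.restrict Ω)) atTop (𝓝 0) ∧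
    Tendsto (fun n => eLpNorm (φ n - (g : Eucl ν → ℂ)) 2 (surf Ω)) atTop (𝓝 0)

theorem grad_add {d : ℕ} {φ ψ : Eucl d → ℂ} (hφ : IsTest φ) (hψ : IsTest ψ) :
    grad (φ + ψ) = grad φ + grad ψ := by
  funext x
  ext i
  have h1 : DifferentiableAt ℝ φ x := (hφ.smooth.differentiable (by simp)) x
  have h2 : DifferentiableAt ℝ ψ x := (hψ.smooth.differentiable (by simp)) x
  simp [grad, fderiv_add h1 h2]

theorem grad_smul {d : ℕ} (c : ℂ) {φ : Eucl d → ℂ} (hφ : IsTest φ) :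
    grad (c • φ) = c • grad φ := by
  funext x
  ext i
  have h1 : DifferentiableAt ℝ φ x := (hφ.smooth.differentiable (by simp)) x
  simp [grad, fderiv_const_smul h1 c]

theorem IsTest.add {d : ℕ} {φ ψ : Eucl d → ℂ} (hφ : IsTest φ) (hψ : IsTest ψ) :
    IsTest (φ + ψ) :=
  ⟨hφ.smooth.add hψ.smooth, hφ.compact.add hψ.compact⟩

theorem IsTest.smul {d : ℕ} (c : ℂ) {φ : Eucl d → ℂ} (hφ : IsTest φ) : IsTest (c • φ) :=
  ⟨hφ.smooth.const_smul c, hφ.compact.smul_left (f := fun _ => c)⟩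

theorem IsTest.zero {d : ℕ} : IsTest (0 : Eucl d → ℂ) :=
  ⟨contDiff_const, HasCompactSupport.zero⟩

theorem IsTest.continuous_grad {d : ℕ} {φ : Eucl d → ℂ} (hφ : IsTest φ) :
    Continuous (grad φ) := by
  have h : Continuous (fderiv ℝ φ) := hφ.smooth.continuous_fderiv (by simp)
  refine (PiLp.continuous_toLp 2 _).comp (continuous_pi fun i => ?_)
  exact h.clm_apply continuous_const

theorem IsTest.integrable_mul {d : ℕ} {φ : Eucl d → ℂ} (hφ : IsTest φ) {Ω : Set (Eucl d)}
    {u : Eucl d → ℂ} (hu : MemLp u 2 (volume.restrict Ω)) :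
    Integrable (fun x => u x * φ x) (volume.restrict Ω) := by
  have h : MemLp φ 2 volume := hφ.smooth.continuous.memLp_of_hasCompactSupport hφ.compact
  exact hu.integrable_mul (h.restrict Ω)

theorem IsTest.integrable_mul_grad {d : ℕ} {φ : Eucl d → ℂ} (hφ : IsTest φ) {Ω : Set (Eucl d)}
    {u : Eucl d → ℂ} (hu : MemLp u 2 (volume.restrict Ω)) (i : Fin d) :
    Integrable (fun x => u x * grad φ x i) (volume.restrict Ω) := by
  have hc : Continuous (fun x => fderiv ℝ φ x (EuclideanSpace.single i 1)) :=
    (hφ.smooth.continuous_fderiv (by simp)).clm_apply continuous_const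
  have hs : HasCompactSupport (fun x => fderiv ℝ φ x (EuclideanSpace.single i 1)) :=
    hφ.compact.fderiv_apply ℝ _
  have h : MemLp (fun x => fderiv ℝ φ x (EuclideanSpace.single i 1)) 2 volume :=
    hc.memLp_of_hasCompactSupport hs
  exact hu.integrable_mul (h.restrict Ω)

theorem HasWeakGrad.memLp_apply {d : ℕ} {Ω : Set (Eucl d)} {u : Eucl d → ℂ}
    {G : Eucl d → EuclideanSpace ℂ (Fin d)} (hu : HasWeakGrad Ω u G) (i : Fin d) :
    MemLp (fun x => G x i) 2 (volume.restrict Ω) :=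
  ((EuclideanSpace.proj i : EuclideanSpace ℂ (Fin d) →L[ℂ] ℂ)).comp_memLp' hu.memLp_grad

theorem HasWeakGrad.add {d : ℕ} {Ω : Set (Eucl d)} {u v : Eucl d → ℂ}
    {G H : Eucl d → EuclideanSpace ℂ (Fin d)} (hu : HasWeakGrad Ω u G) (hv : HasWeakGrad Ω v H) :
    HasWeakGrad Ω (u + v) (G + H) := by
  refine ⟨hu.memLp.add hv.memLp, hu.memLp_grad.add hv.memLp_grad, fun φ hφ hs i => ?_⟩
  have e1 : ∀ x, (u + v) x * grad φ x i = u x * grad φ x i + v x * grad φ x i := by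
    intro x; simp [add_mul]
  have e2 : ∀ x, (G + H) x i * φ x = G x i * φ x + H x i * φ x := by
    intro x; simp [add_mul]
  simp only [e1, e2]
  rw [integral_add (hφ.integrable_mul_grad hu.memLp i) (hφ.integrable_mul_grad hv.memLp i),
    integral_add (hφ.integrable_mul (hu.memLp_apply i)) (hφ.integrable_mul (hv.memLp_apply i)),
    hu.integral_eq φ hφ hs i, hv.integral_eq φ hφ hs i]
  ring

theorem HasWeakGrad.smul {d : ℕ} {Ω : Set (Eucl d)} (c : ℂ) {u : Eucl d → ℂ}
    {G : Eucl d → EuclideanSpace ℂ (Fin d)} (hu : HasWeakGrad Ω u G) :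
    HasWeakGrad Ω (c • u) (c • G) := by
  refine ⟨hu.memLp.const_smul c, hu.memLp_grad.const_smul c, fun φ hφ hs i => ?_⟩
  have e1 : ∀ x, (c • u) x * grad φ x i = c * (u x * grad φ x i) := by
    intro x; simp [mul_assoc]
  have e2 : ∀ x, (c • G) x i * φ x = c * (G x i * φ x) := by
    intro x; simp [mul_assoc]
  simp only [e1, e2, integral_const_mul, hu.integral_eq φ hφ hs i]
  ring

theorem HasWeakGrad.zero {d : ℕ} {Ω : Set (Eucl d)} :
    HasWeakGrad Ω (0 : Eucl d → ℂ) 0 :=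
  ⟨MemLp.zero, MemLp.zero, fun φ _ _ i => by simp⟩

theorem tendsto_eLpNorm_add {α F : Type*} [MeasurableSpace α] [NormedAddCommGroup F]
    {μ : Measure α} {f g : ℕ → α → F} {a b : α → F}
    (hf : ∀ n, AEStronglyMeasurable (f n - a) μ) (hg : ∀ n, AEStronglyMeasurable (g n - b) μ)
    (h1 : Tendsto (fun n => eLpNorm (f n - a) 2 μ) atTop (𝓝 0))
    (h2 : Tendsto (fun n => eLpNorm (g n - b) 2 μ) atTop (𝓝 0)) :
    Tendsto (fun n => eLpNorm (f n + g n - (a + b)) 2 μ) atTop (𝓝 0) := by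
  have h3 := h1.add h2
  rw [add_zero] at h3
  refine tendsto_of_tendsto_of_tendsto_of_le_of_le tendsto_const_nhds h3 (fun _ => zero_le) ?_
  intro n
  have e : f n + g n - (a + b) = (f n - a) + (g n - b) := by abel
  simp only [e]
  exact eLpNorm_add_le (hf n) (hg n) (by norm_num)

theorem tendsto_eLpNorm_smul {α F : Type*} [MeasurableSpace α] [NormedAddCommGroup F]
    [NormedSpace ℂ F] {μ : Measure α} {f : ℕ → α → F} {a : α → F} (c : ℂ)
    (h1 : Tendsto (fun n => eLpNorm (f n - a) 2 μ) atTop (𝓝 0)) :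
    Tendsto (fun n => eLpNorm (c • f n - c • a) 2 μ) atTop (𝓝 0) := by
  simp only [← smul_sub, eLpNorm_const_smul]
  simpa using ENNReal.Tendsto.const_mul h1 (Or.inr (by simp : ‖c‖ₑ ≠ ⊤))

theorem IsTrace.add {ν : ℕ} {Ω : Set (Eucl ν)} {v w : Eucl ν → ℂ} {g h : Lp ℂ 2 (surf Ω)}
    (hv : IsTrace Ω v g) (hw : IsTrace Ω w h) : IsTrace Ω (v + w) (g + h) := by
  obtain ⟨G, hG, φ, hφ, a1, a2, a3⟩ := hv
  obtain ⟨H, hH, ψ, hψ, b1, b2, b3⟩ := hw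
  refine ⟨G + H, hG.add hH, fun n => φ n + ψ n, fun n => (hφ n).add (hψ n), ?_, ?_, ?_⟩
  · exact tendsto_eLpNorm_add
      (fun n => (hφ n).smooth.continuous.aestronglyMeasurable.sub hG.memLp.1)
      (fun n => (hψ n).smooth.continuous.aestronglyMeasurable.sub hH.memLp.1) a1 b1
  · simp only [grad_add (hφ _) (hψ _)]
    exact tendsto_eLpNorm_add
      (fun n => (hφ n).continuous_grad.aestronglyMeasurable.sub hG.memLp_grad.1)
      (fun n => (hψ n).continuous_grad.aestronglyMeasurable.sub hH.memLp_grad.1) a2 b2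
  · have key := tendsto_eLpNorm_add
      (fun n => (hφ n).smooth.continuous.aestronglyMeasurable.sub (Lp.aestronglyMeasurable g))
      (fun n => (hψ n).smooth.continuous.aestronglyMeasurable.sub (Lp.aestronglyMeasurable h))
      a3 b3
    refine key.congr fun n => eLpNorm_congr_ae ?_
    filter_upwards [Lp.coeFn_add g h] with x hx
    simp only [Pi.sub_apply, Pi.add_apply, hx]

theorem IsTrace.smul {ν : ℕ} {Ω : Set (Eucl ν)} (c : ℂ) {v : Eucl ν → ℂ} {g : Lp ℂ 2 (surf Ω)}
    (hv : IsTrace Ω v g) : IsTrace Ω (c • v) (c • g) := by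
  obtain ⟨G, hG, φ, hφ, a1, a2, a3⟩ := hv
  refine ⟨c • G, hG.smul c, fun n => c • φ n, fun n => (hφ n).smul c, ?_, ?_, ?_⟩
  · exact tendsto_eLpNorm_smul c a1
  · simp only [grad_smul c (hφ _)]
    exact tendsto_eLpNorm_smul c a2
  · refine (tendsto_eLpNorm_smul c a3).congr fun n => eLpNorm_congr_ae ?_
    filter_upwards [Lp.coeFn_smul c g] with x hx
    simp only [Pi.sub_apply, hx]

theorem IsTrace.zero {ν : ℕ} {Ω : Set (Eucl ν)} :
    IsTrace Ω (0 : Eucl ν → ℂ) (0 : Lp ℂ 2 (surf Ω)) := by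
  have hg : grad (0 : Eucl ν → ℂ) = 0 := by
    funext x; ext i; simp [grad]
  refine ⟨0, HasWeakGrad.zero, fun _ => 0, fun _ => IsTest.zero, by simp, by simp [hg], ?_⟩
  refine tendsto_const_nhds.congr fun n => ?_
  have : (0 : Eucl ν → ℂ) - ((0 : Lp ℂ 2 (surf Ω)) : Eucl ν → ℂ) =ᵐ[surf Ω] 0 := by
    filter_upwards [Lp.coeFn_zero ℂ 2 (surf Ω)] with x hx
    rw [Pi.sub_apply, hx, sub_self, Pi.zero_apply]
  rw [eLpNorm_congr_ae this, eLpNorm_zero]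

/-- `H^{1/2}(∂Ω)`, the range of the trace operator on `H¹(Ω)`. Its norm is the quotient norm
`‖ψ‖ = inf {‖v‖_{H¹(Ω)} : τv = ψ}`. -/
def HHalf {ν : ℕ} (Ω : Set (Eucl ν)) : Submodule ℂ (Lp ℂ 2 (surf Ω)) where
  carrier := {g | ∃ v, IsTrace Ω v g}
  add_mem' := by
    rintro _ _ ⟨v, hv⟩ ⟨w, hw⟩
    exact ⟨v + w, hv.add hw⟩
  zero_mem' := ⟨0, IsTrace.zero⟩
  smul_mem' := by
    rintro c _ ⟨v, hv⟩
    exact ⟨c • v, hv.smul c⟩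

/-- The trace of an `H¹(Ω)` function as an element of `H^{1/2}(∂Ω)`. -/
def IsTrace.toHHalf {ν : ℕ} {Ω : Set (Eucl ν)} {v : Eucl ν → ℂ} {g : Lp ℂ 2 (surf Ω)}
    (hg : IsTrace Ω v g) : HHalf Ω :=
  ⟨g, v, hg⟩

/-- `ℓ ∈ H^{-1/2}(∂Ω)`, the space of bounded antilinear functionals on `H^{1/2}(∂Ω)`; the bound
is with respect to the quotient norm of `H^{1/2}(∂Ω)`. We read `ℓ ψ` as the sesquilinear duality
pairing `⟨ℓ, ψ⟩`, which extends `∫_{∂Ω} q ψ̄ dS` for `q ∈ L²(∂Ω)`. -/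
def MemHNegHalf {ν : ℕ} {Ω : Set (Eucl ν)} (ℓ : HHalf Ω →ₗ⋆[ℂ] ℂ) : Prop :=
  ∃ C : ℝ, ∀ (v : Eucl ν → ℂ) (G : Eucl ν → EuclideanSpace ℂ (Fin ν)) (ψ : HHalf Ω),
    HasWeakGrad Ω v G → IsTrace Ω v ψ →
      ‖ℓ ψ‖ ≤ C * Real.sqrt ((∫ x in Ω, ‖G x‖ ^ 2) + ∫ x in Ω, ‖v x‖ ^ 2)

/-- The functional `ℓ` on `H^{1/2}(∂Ω)` is given by the function `q ∈ L²(∂Ω)`. -/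
def IsRepresentedBy {ν : ℕ} {Ω : Set (Eucl ν)} (ℓ : HHalf Ω →ₗ⋆[ℂ] ℂ)
    (q : Lp ℂ 2 (surf Ω)) : Prop :=
  ∀ ψ : HHalf Ω, ℓ ψ = ∫ x, q x * conj ((ψ : Lp ℂ 2 (surf Ω)) x) ∂(surf Ω)

/-- `g ∈ H¹(∂Ω)`: near every boundary point, `g` is an `H¹` function in the parameter `y` of a
Lipschitz graph chart. -/
def MemH1Boundary {ν : ℕ} (Ω : Set (Eucl ν)) (g : Lp ℂ 2 (surf Ω)) : Prop :=
  ∀ p ∈ frontier Ω, ∃ c : GraphChart ν, c.IsChart Ω ∧ p ∈ c.U ∧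
    MemH1 (c.param ⁻¹' c.U) (fun y => g (c.param y))

/-! ### The normal derivative and the space `𝒱` -/

/-- `ℓ ∈ H^{-1/2}(∂Ω)` is the outward normal derivative `∂ₙu = ∇u · n` of a function `u ∈ H¹(Ω)`
with `Δu ∈ L²(Ω)`, that is, the normal component of the field `∇u ∈ H(div, Ω)`:
`⟨∂ₙu, φ|_{∂Ω}⟩ = ∫_Ω ∇u · ∇φ̄ + ∫_Ω Δu φ̄` for all functions `φ` smooth up to the boundary. -/
def HasNormalDeriv {ν : ℕ} (Ω : Set (Eucl ν)) (u : Eucl ν → ℂ) (ℓ : HHalf Ω →ₗ⋆[ℂ] ℂ) : Prop :=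
  MemHNegHalf ℓ ∧ ∃ G D, HasWeakGrad Ω u G ∧ HasWeakLaplacian Ω u D ∧
    ∀ φ : Eucl ν → ℂ, IsTest φ → ∀ ψ : HHalf Ω, (ψ : Lp ℂ 2 (surf Ω)) =ᵐ[surf Ω] φ →
      ℓ ψ = (∫ x in Ω, ∑ i, G x i * conj (grad φ x i)) + ∫ x in Ω, D x * conj (φ x)

/-- The normal derivative of `u` is the square integrable function `q` on `∂Ω`. -/
def HasL2NormalDeriv {ν : ℕ} (Ω : Set (Eucl ν)) (u : Eucl ν → ℂ) (q : Lp ℂ 2 (surf Ω)) : Prop :=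
  ∃ ℓ, HasNormalDeriv Ω u ℓ ∧ IsRepresentedBy ℓ q

/-- `u ∈ 𝒱`: `u ∈ H¹(Ω)`, `𝓛u = -Δu - k²u ∈ L²(Ω)`, the trace of `u` lies in `H¹(∂Ω)`, and
`∂ₙu - iku ∈ L²(∂Ω)`. -/
def MemV {ν : ℕ} (Ω : Set (Eucl ν)) (k : ℝ) (u : Eucl ν → ℂ) : Prop :=
  MemH1 Ω u ∧
  (∃ D, HasWeakLaplacian Ω u D ∧ MemLp (helmholtzOp k u D) 2 (volume.restrict Ω)) ∧
  ∃ g, IsTrace Ω u g ∧ MemH1Boundary Ω g ∧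
    ∃ ℓ, HasNormalDeriv Ω u ℓ ∧ ∃ η : Lp ℂ 2 (surf Ω), ∀ ψ : HHalf Ω,
      ℓ ψ - Complex.I * k * ∫ x, g x * conj ((ψ : Lp ℂ 2 (surf Ω)) x) ∂(surf Ω)
        = ∫ x, η x * conj ((ψ : Lp ℂ 2 (surf Ω)) x) ∂(surf Ω)

end Helmholtz

end

namespace Helmholtz

/-! Everything reduces to Green's first identity tested against `u` itself, `⟨∂ₙu, τu⟩ = ∫_Ω |∇u|² +
∫_Ω Δu ū` (`HasNormalDeriv.apply_trace`). Multiply it by the purely imaginary number `ikβ` and take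
real parts: the real quantity `∫|∇u|²` drops out, and so does the `k²|u|²` part of `conj(M₀u) 𝓛u`.
What is left of the volume term, `-2 Re(ikβ ∫ Δu ū)`, cancels against the boundary pairing, while
`ikβ · (-ik) = k²β` makes the `|u|²` boundary terms cancel.

The normal derivative is prescribed only on restrictions of smooth functions, so Green's identity
with `u` as test function needs a density argument: the smooth functions `φₙ` that define the trace
tend to `u` in `H¹(Ω)`, and the `H^{-1/2}` bound carries the pairing to the limit.

For `u ∈ 𝒱` the normal derivative is the `L²` function `η + ik τu`, and the pairing becomes an
integral. -/

/-! ### Weak derivatives: consistency with classical ones, and uniqueness. -/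

theorem IsTest.memLp {d : ℕ} {φ : Eucl d → ℂ} (hφ : IsTest φ) : MemLp φ 2 volume :=
  hφ.smooth.continuous.memLp_of_hasCompactSupport hφ.compact

theorem IsTest.hasCompactSupport_grad {d : ℕ} {φ : Eucl d → ℂ} (hφ : IsTest φ) :
    HasCompactSupport (grad φ) := by
  refine (hφ.compact.fderiv (𝕜 := ℝ)).mono fun x hx => ?_
  contrapose! hx
  have h0 : fderiv ℝ φ x = 0 := by simpa using hx
  have : grad φ x = 0 := by
    ext i
    simp [grad, h0]
  simpa using this

/-- The test function `ψ` vanishes off `Ω`, so the integrals extend to all of `ℝ^d`, where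
integration by parts has no boundary term. -/
theorem IsTest.hasWeakGrad {d : ℕ} {φ : Eucl d → ℂ} (hφ : IsTest φ) (Ω : Set (Eucl d)) :
    HasWeakGrad Ω φ (grad φ) := by
  refine ⟨hφ.memLp.restrict Ω,
    (hφ.continuous_grad.memLp_of_hasCompactSupport hφ.hasCompactSupport_grad).restrict Ω,
    fun ψ hψ hs i => ?_⟩
  have hz : ∀ x, x ∉ Ω → ψ x = 0 := fun x hx => image_eq_zero_of_notMem_tsupport fun h => hx (hs h)
  have hz' : ∀ x, x ∉ Ω → grad ψ x i = 0 := fun x hx => by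
    have : fderiv ℝ ψ x = 0 := image_eq_zero_of_notMem_tsupport
      fun h => hx (hs (tsupport_fderiv_subset ℝ h))
    simp [grad, this]
  rw [setIntegral_eq_integral_of_forall_compl_eq_zero fun x hx => by rw [hz' x hx, mul_zero],
    setIntegral_eq_integral_of_forall_compl_eq_zero fun x hx => by rw [hz x hx, mul_zero]]
  have i1 : Integrable (fun x => φ x * grad ψ x i) := by
    simpa using hψ.integrable_mul_grad (Ω := Set.univ) (hφ.memLp.restrict _) i
  have i2 : Integrable (fun x => ψ x * grad φ x i) := by
    simpa using hφ.integrable_mul_grad (Ω := Set.univ) (hψ.memLp.restrict _) i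
  have i3 : Integrable (fun x => φ x * ψ x) := by
    simpa using hψ.integrable_mul (Ω := Set.univ) (hφ.memLp.restrict _)
  refine integral_mul_fderiv_eq_neg_fderiv_mul_of_integrable ?_ i1 i3
    (fun x _ => hφ.smooth.differentiable (by simp) x)
    (fun x _ => hψ.smooth.differentiable (by simp) x)
  exact i2.congr (.of_forall fun x => mul_comm _ _)

/-- The fundamental lemma of the calculus of variations, for `L²` functions on an open set. -/
theorem ae_eq_of_integral_mul_test_eq {d : ℕ} {Ω : Set (Eucl d)} (hΩ : IsOpen Ω)
    {f g : Eucl d → ℂ} (hf : MemLp f 2 (volume.restrict Ω)) (hg : MemLp g 2 (volume.restrict Ω))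
    (h : ∀ φ : Eucl d → ℂ, IsTest φ → tsupport φ ⊆ Ω →
      ∫ x in Ω, f x * φ x = ∫ x in Ω, g x * φ x) :
    f =ᵐ[volume.restrict Ω] g := by
  have hloc : LocallyIntegrableOn (f - g) Ω volume :=
    locallyIntegrableOn_of_locallyIntegrable_restrict
      ((hf.sub hg).locallyIntegrable (by norm_num))
  -- Real-valued test functions suffice; they are cast to `ℂ` to fit `IsTest`.
  have key := hΩ.ae_eq_zero_of_integral_contDiff_smul_eq_zero hloc fun φ hφ hc hs => by
    have hsupp : tsupport (fun x => (φ x : ℂ)) ⊆ tsupport φ :=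
      closure_mono fun x hx => by simpa using hx
    have ht : IsTest fun x => (φ x : ℂ) :=
      ⟨Complex.ofRealCLM.contDiff.comp hφ, hc.comp_left (g := fun r : ℝ => (r : ℂ)) (by simp)⟩
    have hz : ∀ x, x ∉ Ω → φ x • (f - g) x = 0 := fun x hx => by
      rw [image_eq_zero_of_notMem_tsupport fun h => hx (hs h), zero_smul]
    rw [← setIntegral_eq_integral_of_forall_compl_eq_zero hz]
    have e : ∀ x, φ x • (f - g) x = f x * φ x - g x * φ x := fun x => by
      simp only [Pi.sub_apply, Complex.real_smul]
      ring
    simp only [e]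
    rw [integral_sub (ht.integrable_mul hf) (ht.integrable_mul hg), sub_eq_zero]
    exact h _ ht (hsupp.trans hs)
  rw [Filter.EventuallyEq, ae_restrict_iff' hΩ.measurableSet]
  filter_upwards [key] with x hx hxΩ
  exact sub_eq_zero.1 (hx hxΩ)

/-- Needed because `IsTrace` and `HasNormalDeriv` each supply their own weak gradient of `u`. -/
theorem HasWeakGrad.ae_eq {d : ℕ} {Ω : Set (Eucl d)} (hΩ : IsOpen Ω) {u : Eucl d → ℂ}
    {G H : Eucl d → EuclideanSpace ℂ (Fin d)} (hG : HasWeakGrad Ω u G) (hH : HasWeakGrad Ω u H) :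
    G =ᵐ[volume.restrict Ω] H := by
  have h : ∀ i, (fun x => G x i) =ᵐ[volume.restrict Ω] fun x => H x i := fun i =>
    ae_eq_of_integral_mul_test_eq hΩ (hG.memLp_apply i) (hH.memLp_apply i) fun φ hφ hs =>
      neg_injective ((hG.integral_eq φ hφ hs i).symm.trans (hH.integral_eq φ hφ hs i))
  filter_upwards [ae_all_iff.2 h] with x hx
  ext i
  exact hx i

theorem HasWeakLaplacian.ae_eq {d : ℕ} {Ω : Set (Eucl d)} (hΩ : IsOpen Ω) {u D E : Eucl d → ℂ}
    (hD : HasWeakLaplacian Ω u D) (hE : HasWeakLaplacian Ω u E) :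
    D =ᵐ[volume.restrict Ω] E :=
  ae_eq_of_integral_mul_test_eq hΩ hD.memLp hE.memLp fun φ hφ hs =>
    (hD.integral_eq φ hφ hs).symm.trans (hE.integral_eq φ hφ hs)

/-! ### Convergence in `L²`. -/

theorem integral_norm_sq_eq_toReal_eLpNorm_sq {α E : Type*} [MeasurableSpace α] {μ : Measure α}
    [NormedAddCommGroup E] {f : α → E} (hf : MemLp f 2 μ) :
    ∫ x, ‖f x‖ ^ 2 ∂μ = (eLpNorm f 2 μ).toReal ^ 2 := by
  have h0 : (0 : ℝ) ≤ ∫ x, ‖f x‖ ^ 2 ∂μ := integral_nonneg fun x => by positivity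
  rw [hf.eLpNorm_eq_integral_rpow_norm (by norm_num) (by norm_num),
    ENNReal.toReal_ofReal (by positivity)]
  simp only [ENNReal.toReal_ofNat, Real.rpow_ofNat]
  rw [← Real.rpow_natCast, ← Real.rpow_mul h0]
  norm_num

/-- Continuity of the inner product of the Hilbert space `L²`, read on representatives. -/
theorem tendsto_integral_inner {α E : Type*} [MeasurableSpace α] {μ : Measure α}
    [NormedAddCommGroup E] [InnerProductSpace ℂ E] {f : ℕ → α → E} {a b : α → E} (hf : ∀ n, MemLp (f n) 2 μ)
    (ha : MemLp a 2 μ) (hb : MemLp b 2 μ)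
    (h : Tendsto (fun n => eLpNorm (f n - a) 2 μ) atTop (𝓝 0)) :
    Tendsto (fun n => ∫ x, inner ℂ (f n x) (b x) ∂μ) atTop (𝓝 (∫ x, inner ℂ (a x) (b x) ∂μ)) := by
  have hLp := (Lp.tendsto_Lp_iff_tendsto_eLpNorm'' f hf a ha).2 h
  have e : ∀ {c : α → E} (hc : MemLp c 2 μ),
      inner ℂ (hc.toLp c) (hb.toLp b) = ∫ x, inner ℂ (c x) (b x) ∂μ := fun {c} hc => by
    rw [L2.inner_def]
    refine integral_congr_ae ?_
    filter_upwards [hc.coeFn_toLp, hb.coeFn_toLp] with x h1 h2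
    rw [h1, h2]
  have key := hLp.inner (𝕜 := ℂ) (tendsto_const_nhds (x := hb.toLp b))
  simpa only [e] using key

/-! ### Traces and Green's first identity. -/

theorem IsTest.isTrace_toLp {ν : ℕ} {Ω : Set (Eucl ν)} {φ : Eucl ν → ℂ} (hφ : IsTest φ)
    (hS : MemLp φ 2 (surf Ω)) : IsTrace Ω φ (hS.toLp φ) := by
  refine ⟨grad φ, hφ.hasWeakGrad Ω, fun _ => φ, fun _ => hφ, by simp, by simp, ?_⟩
  have : φ - (hS.toLp φ : Eucl ν → ℂ) =ᵐ[surf Ω] 0 := by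
    filter_upwards [hS.coeFn_toLp] with x hx
    simp [hx]
  simp [eLpNorm_congr_ae this]

/-- The trace of `u` is approximated by restrictions of smooth functions that are square
integrable on `∂Ω`. -/
theorem IsTrace.exists_tendsto {ν : ℕ} {Ω : Set (Eucl ν)} {u : Eucl ν → ℂ} {g : Lp ℂ 2 (surf Ω)}
    (hg : IsTrace Ω u g) :
    ∃ G, HasWeakGrad Ω u G ∧ ∃ φ : ℕ → Eucl ν → ℂ, (∀ n, IsTest (φ n)) ∧
      (∀ n, MemLp (φ n) 2 (surf Ω)) ∧
      Tendsto (fun n => eLpNorm (φ n - u) 2 (volume.restrict Ω)) atTop (𝓝 0) ∧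
      Tendsto (fun n => eLpNorm (grad (φ n) - G) 2 (volume.restrict Ω)) atTop (𝓝 0) := by
  obtain ⟨G, hG, φ, hφ, h1, h2, h3⟩ := hg
  -- An extended-real distance to `g` that tends to `0` is finite from some `N` on; discarding the
  -- earlier terms makes every `φₙ` square integrable on `∂Ω`.
  obtain ⟨N, hN⟩ := eventually_atTop.1 (h3.eventually_lt_const ENNReal.zero_lt_top)
  refine ⟨G, hG, fun n => φ (n + N), fun n => hφ _, fun n => ?_,
    h1.comp (tendsto_add_atTop_nat N), h2.comp (tendsto_add_atTop_nat N)⟩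
  have h : MemLp (φ (n + N) - (g : Eucl ν → ℂ)) 2 (surf Ω) :=
    ⟨(hφ _).smooth.continuous.aestronglyMeasurable.sub (Lp.aestronglyMeasurable g),
      hN _ (Nat.le_add_left N n)⟩
  simpa using h.add (Lp.memLp g)

/-- Green's first identity `⟨∂ₙu, τu⟩ = ∫_Ω |∇u|² + ∫_Ω Δu ū`. -/
theorem HasNormalDeriv.apply_trace {ν : ℕ} {Ω : Set (Eucl ν)} (hΩ : IsOpen Ω) {u D : Eucl ν → ℂ}
    {g : Lp ℂ 2 (surf Ω)} {ℓ : HHalf Ω →ₗ⋆[ℂ] ℂ} (hℓ : HasNormalDeriv Ω u ℓ)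
    (hD : HasWeakLaplacian Ω u D) (hg : IsTrace Ω u g) :
    ∃ G, HasWeakGrad Ω u G ∧
      ℓ hg.toHHalf = ((∫ x in Ω, ‖G x‖ ^ 2 : ℝ) : ℂ) + ∫ x in Ω, D x * conj (u x) := by
  obtain ⟨⟨C, hC⟩, G', D', hG', hD', hφℓ⟩ := hℓ
  obtain ⟨G, hG, φ, hφ, hφS, h1, h2⟩ := hg.exists_tendsto
  refine ⟨G, hG, ?_⟩
  have hgφ n : IsTrace Ω (φ n) ((hφS n).toLp (φ n)) := (hφ n).isTrace_toLp (hφS n)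
  have hw n : HasWeakGrad Ω (u + (-1 : ℂ) • φ n) (G + (-1 : ℂ) • grad (φ n)) :=
    hG.add (((hφ n).hasWeakGrad Ω).smul _)
  have ht n : IsTrace Ω (u + (-1 : ℂ) • φ n) (g + (-1 : ℂ) • (hφS n).toLp (φ n)) :=
    hg.add ((hgφ n).smul _)
  have hsub n : ℓ (ht n).toHHalf = ℓ hg.toHHalf - ℓ (hgφ n).toHHalf := by
    have : (ht n).toHHalf = hg.toHHalf + (-1 : ℂ) • (hgφ n).toHHalf := rfl
    rw [this, map_add, map_smulₛₗ]
    simp [sub_eq_add_neg]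
  -- The bound on `ℓ` is applied to the difference of traces, with `u - φₙ` itself as the `H¹` lift.
  have hbound n : ‖ℓ hg.toHHalf - ℓ (hgφ n).toHHalf‖ ≤
      C * Real.sqrt ((eLpNorm (grad (φ n) - G) 2 (volume.restrict Ω)).toReal ^ 2
        + (eLpNorm (φ n - u) 2 (volume.restrict Ω)).toReal ^ 2) := by
    have e1 : G + (-1 : ℂ) • grad (φ n) = -(grad (φ n) - G) := by
      rw [neg_one_smul]; abel
    have e2 : u + (-1 : ℂ) • φ n = -(φ n - u) := by
      rw [neg_one_smul]; abel
    have := hC _ _ (ht n).toHHalf (hw n) (ht n)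
    rw [hsub, integral_norm_sq_eq_toReal_eLpNorm_sq (hw n).memLp_grad,
      integral_norm_sq_eq_toReal_eLpNorm_sq (hw n).memLp] at this
    simpa only [e1, e2, eLpNorm_neg] using this
  have hlim0 : Tendsto (fun n => C *
      Real.sqrt ((eLpNorm (grad (φ n) - G) 2 (volume.restrict Ω)).toReal ^ 2
        + (eLpNorm (φ n - u) 2 (volume.restrict Ω)).toReal ^ 2)) atTop (𝓝 0) := by
    have a := ((ENNReal.tendsto_toReal ENNReal.zero_ne_top).comp h2).pow 2
    have b := ((ENNReal.tendsto_toReal ENNReal.zero_ne_top).comp h1).pow 2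
    simpa using ((a.add b).sqrt).const_mul C
  have hlim1 : Tendsto (fun n => ℓ (hgφ n).toHHalf) atTop (𝓝 (ℓ hg.toHHalf)) := by
    have := (squeeze_zero_norm hbound hlim0).const_sub (ℓ hg.toHHalf)
    simpa using this
  -- The defining formula on smooth functions, with `G'`, `D'` replaced a.e. by `G`, `D`. The inner
  -- product is antilinear in its first slot, hence `φₙ` stands there.
  have hval n : ℓ (hgφ n).toHHalf =
      (∫ x in Ω, inner ℂ (grad (φ n) x) (G x)) + ∫ x in Ω, inner ℂ (φ n x) (D x) := by
    rw [hφℓ (φ n) (hφ n) _ (hφS n).coeFn_toLp]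
    congr 1
    · refine integral_congr_ae ?_
      filter_upwards [hG'.ae_eq hΩ hG] with x hx
      simp [PiLp.inner_apply, hx]
    · refine integral_congr_ae ?_
      filter_upwards [hD'.ae_eq hΩ hD] with x hx
      simp [hx]
  have hlim2 := (tendsto_integral_inner (fun n => ((hφ n).hasWeakGrad Ω).memLp_grad)
    hG.memLp_grad hG.memLp_grad h2).add
    (tendsto_integral_inner (fun n => ((hφ n).hasWeakGrad Ω).memLp) hG.memLp hD.memLp h1)
  simp only [← hval] at hlim2
  rw [tendsto_nhds_unique hlim1 hlim2, ← integral_complex_ofReal]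
  congr 1
  refine integral_congr_ae (.of_forall fun x => ?_)
  simp [inner_self_eq_norm_sq_to_K]

/-! ### The Morawetz identity. -/

theorem integrable_mul_conj {α : Type*} [MeasurableSpace α] {μ : Measure α} {f g : α → ℂ}
    (hf : MemLp f 2 μ) (hg : MemLp g 2 μ) : Integrable (fun x => f x * conj (g x)) μ :=
  hf.integrable_mul hg.star

theorem integral_mul_conj_self {α : Type*} [MeasurableSpace α] {μ : Measure α} (f : α → ℂ) :
    ∫ x, f x * conj (f x) ∂μ = ((∫ x, ‖f x‖ ^ 2 ∂μ : ℝ) : ℂ) := by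
  simp only [Complex.mul_conj, Complex.normSq_eq_norm_sq, integral_complex_ofReal]

/-- The split isolates `u ū`, a real factor with an imaginary coefficient, which disappears from the
real part. -/
theorem conj_multM0_mul_helmholtzOp {d : ℕ} (k β : ℝ) (u D : Eucl d → ℂ) (x : Eucl d) :
    conj (multM0 k β u x) * helmholtzOp k u D x =
      -(Complex.I * k * β) * (D x * conj (u x)) + -(Complex.I * k ^ 3 * β) * (u x * conj (u x)) := by
  simp only [multM0, helmholtzOp, map_mul, map_neg, Complex.conj_I, Complex.conj_ofReal]
  ring

theorem integrable_conj_multM0_mul_helmholtzOp {d : ℕ} {Ω : Set (Eucl d)} (k β : ℝ)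
    {u D : Eucl d → ℂ} (hu : MemLp u 2 (volume.restrict Ω)) (hD : MemLp D 2 (volume.restrict Ω)) :
    IntegrableOn (fun x => conj (multM0 k β u x) * helmholtzOp k u D x) Ω := by
  simp only [conj_multM0_mul_helmholtzOp]
  exact ((integrable_mul_conj hD hu).const_mul _).add ((integrable_mul_conj hu hu).const_mul _)

/-- The low-order Morawetz identity, with the boundary term read as a duality pairing. -/
theorem morawetz_identity {ν : ℕ} {Ω : Set (Eucl ν)} (hΩ : IsOpen Ω) (k β : ℝ) {u D : Eucl ν → ℂ}
    {g : Lp ℂ 2 (surf Ω)} {ℓ : HHalf Ω →ₗ⋆[ℂ] ℂ} (hD : HasWeakLaplacian Ω u D)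
    (hg : IsTrace Ω u g) (hℓ : HasNormalDeriv Ω u ℓ) :
    (∫ x in Ω, 2 * (conj (multM0 k β u x) * helmholtzOp k u D x).re)
      - 2 * k ^ 2 * β * (∫ x, ‖g x‖ ^ 2 ∂(surf Ω))
      + 2 * (Complex.I * k * β *
          (ℓ hg.toHHalf - Complex.I * k * ((∫ x, ‖g x‖ ^ 2 ∂(surf Ω) : ℝ) : ℂ))).re = 0 := by
  obtain ⟨G, hG, h⟩ := hℓ.apply_trace hΩ hD hg
  have hint := integrable_conj_multM0_mul_helmholtzOp k β hG.memLp hD.memLp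
  have hre : ∫ x in Ω, (conj (multM0 k β u x) * helmholtzOp k u D x).re =
      (∫ x in Ω, conj (multM0 k β u x) * helmholtzOp k u D x).re := integral_re hint
  rw [integral_const_mul, hre, h]
  simp only [conj_multM0_mul_helmholtzOp]
  rw [integral_add ((integrable_mul_conj hD.memLp hG.memLp).const_mul _)
    ((integrable_mul_conj hG.memLp hG.memLp).const_mul _), integral_const_mul,
    integral_const_mul, integral_mul_conj_self]
  -- Only `z` is complex; `a`, `b`, `c` are real, so the claim becomes algebra in real and imaginary
  -- parts.
  generalize (∫ x in Ω, D x * conj (u x)) = z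
  generalize (∫ x in Ω, ‖u x‖ ^ 2) = a
  generalize (∫ x in Ω, ‖G x‖ ^ 2) = b
  generalize (∫ x, ‖g x‖ ^ 2 ∂(surf Ω)) = c
  simp [pow_succ]
  ring

theorem MemV.exists_L2_data {ν : ℕ} {Ω : Set (Eucl ν)} {k : ℝ} {u : Eucl ν → ℂ}
    (hu : MemV Ω k u) :
    ∃ D g q, HasWeakLaplacian Ω u D ∧ IsTrace Ω u g ∧ HasL2NormalDeriv Ω u q := by
  obtain ⟨-, ⟨D, hD, -⟩, g, hg, -, ℓ, hℓ, η, hη⟩ := hu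
  -- The witness solves `∂ₙu - iku = η` for `∂ₙu`.
  refine ⟨D, g, η + (Complex.I * k) • g, hD, hg, ℓ, hℓ, fun ψ => ?_⟩
  rw [sub_eq_iff_eq_add.1 (hη ψ), ← integral_const_mul,
    ← integral_add (integrable_mul_conj (Lp.memLp η) (Lp.memLp _))
      ((integrable_mul_conj (Lp.memLp g) (Lp.memLp _)).const_mul _)]
  refine integral_congr_ae ?_
  filter_upwards [Lp.coeFn_add η ((Complex.I * k) • g), Lp.coeFn_smul (Complex.I * (k : ℂ)) g]
    with x h1 h2
  rw [h1, Pi.add_apply, h2, Pi.smul_apply, smul_eq_mul]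
  ring

end Helmholtz

theorem mainTheorem7 {ν : ℕ} (hν : 1 ≤ ν) (Ω : Set (Helmholtz.Eucl ν))
    (hΩ : Helmholtz.IsBoundedLipschitzDomain Ω) (k β : ℝ) (hk : 0 < k)
    (u : Helmholtz.Eucl ν → ℂ) :
    (Helmholtz.MemV Ω k u →
      (∃ D g q, Helmholtz.HasWeakLaplacian Ω u D ∧ Helmholtz.IsTrace Ω u g ∧
        Helmholtz.HasL2NormalDeriv Ω u q) ∧
      ∀ (D : Helmholtz.Eucl ν → ℂ) (g q : Lp ℂ 2 (Helmholtz.surf Ω)),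
        Helmholtz.HasWeakLaplacian Ω u D → Helmholtz.IsTrace Ω u g →
        Helmholtz.HasL2NormalDeriv Ω u q →
        IntegrableOn
          (fun x => conj (Helmholtz.multM0 k β u x) * Helmholtz.helmholtzOp k u D x) Ω ∧
        Integrable (fun x => ‖g x‖ ^ 2) (Helmholtz.surf Ω) ∧
        Integrable (fun x => Complex.I * k * β * conj (g x) * (q x - Complex.I * k * g x))
          (Helmholtz.surf Ω) ∧
        (∫ x in Ω, 2 * (conj (Helmholtz.multM0 k β u x) * Helmholtz.helmholtzOp k u D x).re)
          - 2 * k ^ 2 * β * (∫ x, ‖g x‖ ^ 2 ∂(Helmholtz.surf Ω))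
          + 2 * (∫ x, Complex.I * k * β * conj (g x) * (q x - Complex.I * k * g x)
              ∂(Helmholtz.surf Ω)).re = 0) ∧
    (∀ (D : Helmholtz.Eucl ν → ℂ) (g : Lp ℂ 2 (Helmholtz.surf Ω))
        (ℓ : Helmholtz.HHalf Ω →ₗ⋆[ℂ] ℂ),
        Helmholtz.HasWeakLaplacian Ω u D → ∀ hg : Helmholtz.IsTrace Ω u g,
        Helmholtz.HasNormalDeriv Ω u ℓ →
        (∫ x in Ω, 2 * (conj (Helmholtz.multM0 k β u x) * Helmholtz.helmholtzOp k u D x).re)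
          - 2 * k ^ 2 * β * (∫ x, ‖g x‖ ^ 2 ∂(Helmholtz.surf Ω))
          + 2 * (Complex.I * k * β *
              (ℓ hg.toHHalf - Complex.I * k * ((∫ x, ‖g x‖ ^ 2 ∂(Helmholtz.surf Ω) : ℝ) : ℂ))).re
          = 0) := by
  have hO := hΩ.isOpen
  refine ⟨fun hV => ⟨hV.exists_L2_data, fun D g q hD hg ⟨ℓ, hℓ, hq⟩ => ?_⟩,
    fun D g ℓ hD hg hℓ => Helmholtz.morawetz_identity hO k β hD hg hℓ⟩
  obtain ⟨G, hG, -⟩ := id hg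
  have hgg := Helmholtz.integrable_mul_conj (Lp.memLp g) (Lp.memLp g)
  have hqg := Helmholtz.integrable_mul_conj (Lp.memLp q) (Lp.memLp g)
  have e : ∀ x, Complex.I * k * β * conj (g x) * (q x - Complex.I * k * g x) =
      Complex.I * k * β * (q x * conj (g x) - Complex.I * k * (g x * conj (g x))) := fun x => by
    ring
  have hqgg := hqg.sub (hgg.const_mul (Complex.I * k))
  refine ⟨Helmholtz.integrable_conj_multM0_mul_helmholtzOp k β hG.memLp hD.memLp,
    (Lp.memLp g).integrable_norm_pow (by norm_num), ?_, ?_⟩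
  · simp only [e]
    exact hqgg.const_mul _
  · have key := Helmholtz.morawetz_identity hO k β hD hg hℓ
    -- Evaluating the representation of `ℓ` at `ψ = τu` turns the pairing into `∫ q ḡ dS`.
    rw [hq, ← Helmholtz.integral_mul_conj_self] at key
    have h : ∫ x, Complex.I * k * β * conj (g x) * (q x - Complex.I * k * g x)
          ∂(Helmholtz.surf Ω) =
        Complex.I * k * β * (∫ x, q x * conj (g x) ∂(Helmholtz.surf Ω)
          - Complex.I * k * ∫ x, g x * conj (g x) ∂(Helmholtz.surf Ω)) := by
      simp only [e]
      rw [integral_const_mul, integral_sub hqg (hgg.const_mul _), integral_const_mul]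
    rw [h]
    exact key
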